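/- For an ordinal $\beta$ let $V_\beta$ be the $\beta$-th stage of the cumulative hierarchy. Rank potentialism is the Kripke model $\mathcal V$ whose worlds are the structures $(V_\beta,\in)$, for all ordinals $\beta$, where $V_\beta$ accesses $V_\delta$ if and only if $\beta\le\delta$. Let $\mathcal L_\in$ be the first-order language of set theory, and let $\mathcal L_\in^\Diamond$ be its expansion by the modal operators $\Diamond,\Box$. Truth of an $\mathcal L_\in^\Diamond$-formula at $V_\beta$, with parameters from $V_\beta$, is defined as usual: quantifiers range over $V_\beta$, and $\Box\varphi$ holds at $V_\beta$ if $\varphi$ holds at every $V_\delta$ with $\delta\ge\beta$. If $\Gamma$ is a class of assertions, then $\mathrm{Val}_{\mathcal V}(V_\beta,\Gamma)$ is the set of all propositional modal formulas $\varphi(p_0,\dots,p_n)$ such that every substitution instance $\varphi(\psi_0,\dots,\psi_n)$ with $\psi_i\in\Gamma$ is true at $V_\beta$, and $\mathrm{Val}_{\mathcal V}(\Gamma)$ is the set of those valid at every world $V_\beta$ (with parameters from $V_\beta$, where $\Gamma$ allows parameters). $\mathcal L_\in$ denotes the class of sentences of $\mathcal L_\in$ (without parameters), and $\mathcal L^\Diamond_{\in,V_\beta}$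 the class of $\mathcal L_\in^\Diamond$-assertions with parameters from $V_\beta$. Let $\mathrm{S4.3}$ be the normal modal logic axiomatized by $\Box(p\to q)\to(\Box p\to\Box q)$, $\Box p\to p$, $\Box p\to\Box\Box p$ and $(\Diamond p\wedge\Diamond q)\to\Diamond[(p\wedge\Diamond q)\vee(q\wedge\Diamond p)]$. 1. There is an ordinal $\beta$ with $$\mathrm{S4.3}=\mathrm{Val}_{\mathcal V}(V_\beta,\mathcal L^\Diamond_{\in,V_\beta})=\mathrm{Val}_{\mathcal V}(V_\beta,\mathcal L_\in).$$ 2. $\mathrm{Val}_{\mathcal V}(\mathcal L_\in)=\mathrm{S4.3}$. Furthermore, $\mathrm{Val}_{\mathcal V}(\mathcal L_\in^+)=\mathrm{S4.3}$ for every language $\mathcal L_\in^+$ that extends $\mathcal L_\in$ by parameters, relations or modal vocabulary. Precisely: expand the structures $(V_\beta,\in)$ in any way to structures for a first-order language $\mathcal L\supseteq\mathcal L_\in$, possibly add to $\Diamond,\Box$ further modal operators, each interpreted by a relation between worlds that relates $V_\beta$ to $V_\delta$ only if $\beta\le\delta$, and at each world $V_\beta$ take any class of assertions of the resulting modal language with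 parameters from $V_\beta$ that contains all sentences of $\mathcal L_\in$; then the propositional modal formulas valid at every world for these classes are exactly those of $\mathrm{S4.3}$. -/

import Mathlib

open FirstOrder

universe u v w x y z

/-! ### Propositional modal logic and the theory S4.3 -/

/-- Formulas of propositional modal logic, in the propositional variables `p₀, p₁, …`.
The primitive symbols are `⊥`, `→` and `□`; the others are the usual classical abbreviations. -/
inductive ModalProp : Type
  | var : ℕ → ModalProp
  | bot : ModalProp
  | imp : ModalProp → ModalProp → ModalProp
  | box : ModalProp → ModalProp

namespace ModalProp

/-- Negation. -/
def neg (φ : ModalProp) : ModalProp := φ.imp bot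

/-- Disjunction. -/
def or (φ ψ : ModalProp) : ModalProp := φ.neg.imp ψ

/-- Conjunction. -/
def and (φ ψ : ModalProp) : ModalProp := (φ.imp ψ.neg).neg

/-- Possibility, `◇ φ := ¬ □ ¬ φ`. -/
def dia (φ : ModalProp) : ModalProp := φ.neg.box.neg

/-- `φ` is a substitution instance of a classical propositional tautology: it is true under every
assignment of truth values to modal formulas that respects `⊥` and `→`. -/
def IsTautology (φ : ModalProp) : Prop :=
  ∀ t : ModalProp → Prop, ¬ t bot → (∀ a b, t (a.imp b) ↔ (t a → t b)) → t φ

end ModalProp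

/-- Provability in S4.3: the normal modal logic with the axioms K, T, 4 and .3. -/
inductive ProvableS43 : ModalProp → Prop
  | taut (φ : ModalProp) : φ.IsTautology → ProvableS43 φ
  | axK (φ ψ : ModalProp) : ProvableS43 ((φ.imp ψ).box.imp (φ.box.imp ψ.box))
  | axT (φ : ModalProp) : ProvableS43 (φ.box.imp φ)
  | ax4 (φ : ModalProp) : ProvableS43 (φ.box.imp φ.box.box)
  | ax3 (φ ψ : ModalProp) :
      ProvableS43 ((φ.dia.and ψ.dia).imp ((φ.and ψ.dia).or (ψ.and φ.dia)).dia)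
  | mp (φ ψ : ModalProp) : ProvableS43 (φ.imp ψ) → ProvableS43 φ → ProvableS43 ψ
  | nec (φ : ModalProp) : ProvableS43 φ → ProvableS43 φ.box

/-- The modal theory S4.3, as a set of propositional modal formulas. -/
def S43 : Set ModalProp := {φ | ProvableS43 φ}

/-! ### Potentialist systems and the potentialist language -/

/-- A potentialist system of `L`-structures: a reflexive transitive Kripke model of `L`-structures
whose domains grow along the accessibility relation. The type `M` indexes further modal operators
that the language may have in addition to the operators `◇`, `□` of the system (`M` is empty for
the plain potentialist language); each comes with its own accessibility relation, along which
domains grow as well. -/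
structure PotentialistSystem (L : FirstOrder.Language.{u, v}) (M : Type w) where
  /-- The type in which all the individuals live. -/
  Carrier : Type x
  /-- The worlds. -/
  World : Type y
  /-- The domain of a world. -/
  dom : World → Set Carrier
  /-- Every world is an `L`-structure. -/
  str : ∀ W, L.Structure (dom W)
  /-- The accessibility relation of the system. -/
  Acc : World → World → Prop
  acc_refl : ∀ W, Acc W W
  acc_trans : ∀ W U X, Acc W U → Acc U X → Acc W X
  dom_mono : ∀ W U, Acc W U → dom W ⊆ dom U
  /-- The accessibility relations of the additional modal operators. -/
  ExtraAcc : M → World → World → Prop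
  extra_dom_mono : ∀ m W U, ExtraAcc m W U → dom W ⊆ dom U

attribute [instance] PotentialistSystem.str

/-- Formulas of the potentialist language `L^◇` (with additional modal operators indexed by `M`),
with free variables indexed by `α` and by `Fin n`. -/
inductive PotFormula (L : FirstOrder.Language.{u, v}) (M : Type w) (α : Type x) :
    ℕ → Type (max u v w x)
  | falsum {n : ℕ} : PotFormula L M α n
  | equal {n : ℕ} (t₁ t₂ : L.Term (α ⊕ Fin n)) : PotFormula L M α n
  | rel {n l : ℕ} (R : L.Relations l) (ts : Fin l → L.Term (α ⊕ Fin n)) : PotFormula L M α n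
  | imp {n : ℕ} (f g : PotFormula L M α n) : PotFormula L M α n
  | all {n : ℕ} (f : PotFormula L M α (n + 1)) : PotFormula L M α n
  | box {n : ℕ} (f : PotFormula L M α n) : PotFormula L M α n
  | extraBox {n : ℕ} (m : M) (f : PotFormula L M α n) : PotFormula L M α n

namespace PotFormula

variable {L : FirstOrder.Language.{u, v}} {M : Type w} {α : Type x}

/-- An ordinary first-order formula, seen as a formula of the potentialist language; its free
variables are renamed along `g`. -/
def ofBounded {α' : Type y} (g : α' → α) : {n : ℕ} → L.BoundedFormula α' n → PotFormula L M α n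
  | _, .falsum => .falsum
  | _, .equal t₁ t₂ => .equal (t₁.relabel (Sum.map g id)) (t₂.relabel (Sum.map g id))
  | _, .rel R ts => .rel R fun i => (ts i).relabel (Sum.map g id)
  | _, .imp f₁ f₂ => .imp (ofBounded g f₁) (ofBounded g f₂)
  | _, .all f => .all (ofBounded g f)

/-- A first-order sentence, seen as an assertion of the potentialist language (with parameters
allowed, but not used). -/
def ofSentence (σ : L.Sentence) : PotFormula L M α 0 := ofBounded Empty.elim σ

/-- The substitution instance `φ(ψ₀, ψ₁, …)` of a propositional modal formula `φ`. -/
def instantiate (ψ : ℕ → PotFormula L M α 0) : ModalProp → PotFormula L M α 0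
  | .var i => ψ i
  | .bot => .falsum
  | .imp a b => .imp (instantiate ψ a) (instantiate ψ b)
  | .box a => .box (instantiate ψ a)

/-- The potentialist semantics: truth of a formula at a world `W` of `S`, the free variables being
assigned individuals of `W`. Quantifiers range over the individuals of the current world. -/
def Realize (S : PotentialistSystem.{u, v, w, y, z} L M) : {n : ℕ} → PotFormula L M α n →
    (W : S.World) → (α → S.dom W) → (Fin n → S.dom W) → Prop
  | _, falsum, _, _, _ => False
  | _, equal t₁ t₂, _, a, xs => t₁.realize (Sum.elim a xs) = t₂.realize (Sum.elim a xs)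
  | _, rel R ts, _, a, xs =>
      Language.Structure.RelMap R fun i => (ts i).realize (Sum.elim a xs)
  | _, imp f g, W, a, xs => f.Realize S W a xs → g.Realize S W a xs
  | _, all f, W, a, xs => ∀ b : S.dom W, f.Realize S W a (Fin.snoc xs b)
  | _, box f, W, a, xs => ∀ (U : S.World) (h : S.Acc W U),
      f.Realize S U (Set.inclusion (S.dom_mono W U h) ∘ a) (Set.inclusion (S.dom_mono W U h) ∘ xs)
  | _, extraBox m f, W, a, xs => ∀ (U : S.World) (h : S.ExtraAcc m W U),
      f.Realize S U (Set.inclusion (S.extra_dom_mono m W U h) ∘ a)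
        (Set.inclusion (S.extra_dom_mono m W U h) ∘ xs)

end PotFormula

namespace PotentialistSystem

variable {L : FirstOrder.Language.{u, v}} {M : Type w} (S : PotentialistSystem.{u, v, w, x, y} L M)

/-- The assertions of the potentialist language that can be made at `W`, with parameters from `W`:
the variables in `S.dom W` serve as names of the individuals of `W`. -/
abbrev Assertion (W : S.World) : Type _ := PotFormula L M (S.dom W) 0

/-- Truth at `W` of an assertion with parameters from `W`. -/
def Holds (W : S.World) (ψ : S.Assertion W) : Prop := ψ.Realize S W id Fin.elim0

/-- The propositional modal formulas valid at the world `W` for the assertions in `Γ`: all their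
substitution instances by assertions from `Γ` are true at `W`. -/
def valAt (W : S.World) (Γ : Set (S.Assertion W)) : Set ModalProp :=
  {φ | ∀ ψ : ℕ → S.Assertion W, (∀ i, ψ i ∈ Γ) → S.Holds W (PotFormula.instantiate ψ φ)}

/-- The propositional modal formulas valid at every world, for the assertions in `Γ W` at `W`. -/
def val (Γ : ∀ W, Set (S.Assertion W)) : Set ModalProp := {φ | ∀ W, φ ∈ S.valAt W (Γ W)}

/-- The first-order sentences: no parameters and no modal operators. -/
def sentences (W : S.World) : Set (S.Assertion W) :=
  Set.range fun σ : L.Sentence => PotFormula.ofSentence σ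

end PotentialistSystem

/-! ### Rank potentialism -/

/-- The relation symbols of the language of set theory: one binary symbol. -/
inductive SetMemRel : ℕ → Type
  | mem : SetMemRel 2

/-- The first-order language of set theory. -/
def setLang : FirstOrder.Language.{0, 0} := ⟨fun _ => Empty, SetMemRel⟩

/-- The domain of the world `V_β`. -/
def vStage (β : Ordinal.{u}) : Set ZFSet.{u} := {a | a ∈ ZFSet.vonNeumann β}

/-- `V_β` as a structure in the language of set theory. -/
instance vStage.structure (β : Ordinal.{u}) : setLang.Structure (vStage β) where
  funMap f := f.elim
  RelMap R xs := match R with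
    | SetMemRel.mem => (xs 0 : ZFSet.{u}) ∈ (xs 1 : ZFSet.{u})

theorem vStage_mono {β δ : Ordinal.{u}} (h : β ≤ δ) : vStage β ⊆ vStage δ :=
  fun _ ha => ZFSet.vonNeumann_subset_of_le h ha

/-- The system of rank potentialism with the worlds `V_β` made into structures for a language `L`
in some way, and with additional modal operators interpreted by relations `R m` between worlds.
The world `V_β` accesses `V_δ` if and only if `β ≤ δ`. -/
def rankSystemWith (L : FirstOrder.Language.{v, w}) (str : ∀ β : Ordinal.{u}, L.Structure (vStage β))
    (M : Type x) (R : M → Ordinal.{u} → Ordinal.{u} → Prop)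
    (hR : ∀ m β δ, R m β δ → β ≤ δ) : PotentialistSystem.{v, w, x, u + 1, u + 1} L M where
  Carrier := ZFSet.{u}
  World := Ordinal.{u}
  dom := vStage
  str := str
  Acc β δ := β ≤ δ
  acc_refl := le_refl
  acc_trans _ _ _ := le_trans
  dom_mono _ _ := vStage_mono
  ExtraAcc := R
  extra_dom_mono m β δ h := vStage_mono (hR m β δ h)

/-- Rank potentialism in the language of set theory: the worlds are the structures `(V_β, ∈)`,
and `◇`, `□` are the only modal operators. -/
def rankSystem : PotentialistSystem.{0, 0, 0, u + 1, u + 1} setLang Empty :=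
  rankSystemWith setLang vStage.structure Empty (fun m => m.elim) (fun m => m.elim)

/-! The worlds form a linear order under accessibility, so a substitution instance is evaluated in a
reflexive, transitive, forward connected Kripke model. Such models validate S4.3 whatever the
assertions are, which gives the lower bound at every world.

For the upper bound, a formula that S4.3 does not prove fails at the first point of a finite linear
preorder on `Fin (n + 1)` (canonical model, filtration, sorting:
`exists_not_sat_of_not_provableS43`). It remains to map the ordinals from 1 on to this preorder by a
map with the forth and back properties, sending 1 to the first point, such that each fibre is
defined by a parameter-free sentence; these sentences carry the counterexample to the world `V_1`.

The map reads two things off β: which of the thresholds ω^(n+1+i) it has passed (never undone, hence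
able to climb through the preorder), and which powers ω^j divide it (changeable at will inside an
interval between thresholds, hence able to move around a cluster). Both are expressible in `V_β`
with membership alone, without coding pairs or functions, which are unavailable at low ranks: the
property `LimitLike j` forces ω^j to divide the rank and is equivalent to this for the sets `V_α`.
-/

/-! ### Kripke semantics -/

namespace ModalProp

/-- Truth of a modal formula at a point of a Kripke model with accessibility relation `R` and
valuation `V`. -/
def Sat {W : Type*} (R : W → W → Prop) (V : ℕ → W → Prop) : ModalProp → W → Prop
  | var i, a => V i a
  | bot, _ => False
  | imp φ ψ, a => Sat R V φ a → Sat R V ψ a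
  | box φ, a => ∀ b, R a b → Sat R V φ b

section Sat

variable {W : Type*} {R : W → W → Prop} {V : ℕ → W → Prop} {a : W} {φ ψ : ModalProp}

theorem sat_neg : Sat R V φ.neg a ↔ ¬ Sat R V φ a := Iff.rfl

theorem sat_or : Sat R V (φ.or ψ) a ↔ Sat R V φ a ∨ Sat R V ψ a := by
  simp only [or, Sat, sat_neg]; tauto

theorem sat_and : Sat R V (φ.and ψ) a ↔ Sat R V φ a ∧ Sat R V ψ a := by
  simp only [and, Sat, sat_neg]; tauto

theorem sat_dia : Sat R V φ.dia a ↔ ∃ b, R a b ∧ Sat R V φ b := by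
  simp only [dia, Sat, sat_neg]; push Not; rfl

/-- A map with the forth and back properties preserves truth. -/
theorem sat_comp_iff {W' : Type*} {R' : W' → W' → Prop} {V' : ℕ → W' → Prop} (f : W → W')
    (forth : ∀ a b, R a b → R' (f a) (f b)) (back : ∀ a u, R' (f a) u → ∃ b, R a b ∧ f b = u)
    (hV : ∀ i a, V i a ↔ V' i (f a)) (φ : ModalProp) :
    ∀ a, Sat R V φ a ↔ Sat R' V' φ (f a) := by
  induction φ with
  | var i => exact hV i
  | bot => exact fun _ => Iff.rfl
  | imp φ ψ hφ hψ => exact fun a => imp_congr (hφ a) (hψ a)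
  | box φ ih =>
    refine fun a => ⟨fun h u hu => ?_, fun h b hb => (ih b).2 (h _ (forth _ _ hb))⟩
    obtain ⟨b, hb, rfl⟩ := back a u hu
    exact (ih b).1 (h b hb)

end Sat

end ModalProp

open ModalProp

/-- Soundness of S4.3 for reflexive, transitive and forward connected Kripke models. -/
theorem ProvableS43.sat {W : Type*} {R : W → W → Prop} {V : ℕ → W → Prop} (hr : ∀ a, R a a)
    (ht : ∀ a b c, R a b → R b c → R a c) (hc : ∀ a b c, R a b → R a c → R b c ∨ R c b)
    {φ : ModalProp} (h : ProvableS43 φ) : ∀ a, Sat R V φ a := by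
  induction h with
  | taut φ h => exact fun a => h (fun χ => Sat R V χ a) id fun _ _ => Iff.rfl
  | axK φ ψ => exact fun a h h' b hb => h b hb (h' b hb)
  | axT φ => exact fun a h => h a (hr a)
  | ax4 φ => exact fun a h b hb c hbc => h c (ht _ _ _ hb hbc)
  | ax3 φ ψ =>
    intro a h
    obtain ⟨h₁, h₂⟩ := sat_and.1 h
    obtain ⟨b, hb, hφ⟩ := sat_dia.1 h₁
    obtain ⟨c, hc', hψ⟩ := sat_dia.1 h₂
    rcases hc a b c hb hc' with hbc | hcb
    · exact sat_dia.2 ⟨b, hb, sat_or.2 (.inl (sat_and.2 ⟨hφ, sat_dia.2 ⟨c, hbc, hψ⟩⟩))⟩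
    · exact sat_dia.2 ⟨c, hc', sat_or.2 (.inr (sat_and.2 ⟨hψ, sat_dia.2 ⟨b, hcb, hφ⟩⟩))⟩
  | mp φ ψ _ _ h₁ h₂ => exact fun a => h₁ a (h₂ a)
  | nec φ _ h => exact fun a b _ => h b

/-! ### Maximal consistent sets -/

/-- Derivability from hypotheses by modus ponens, with the theorems of S4.3 as axioms. -/
inductive DerivableS43 (Γ : Set ModalProp) : ModalProp → Prop
  | hyp (φ : ModalProp) : φ ∈ Γ → DerivableS43 Γ φ
  | thm (φ : ModalProp) : ProvableS43 φ → DerivableS43 Γ φ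
  | mp (φ ψ : ModalProp) : DerivableS43 Γ (φ.imp ψ) → DerivableS43 Γ φ → DerivableS43 Γ ψ

namespace DerivableS43

variable {Γ Δ : Set ModalProp} {φ ψ : ModalProp}

theorem mono (h : Γ ⊆ Δ) (hφ : DerivableS43 Γ φ) : DerivableS43 Δ φ := by
  induction hφ with
  | hyp φ hφ => exact hyp φ (h hφ)
  | thm φ hφ => exact thm φ hφ
  | mp φ ψ _ _ h₁ h₂ => exact mp φ ψ h₁ h₂

theorem provable (h : DerivableS43 ∅ φ) : ProvableS43 φ := by
  induction h with
  | hyp φ hφ => exact hφ.elim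
  | thm φ hφ => exact hφ
  | mp φ ψ _ _ h₁ h₂ => exact .mp φ ψ h₁ h₂

/-- Necessitation applies to theorems only and never to hypotheses, so modus ponens is the only rule
the induction has to handle. -/
theorem deduction (h : DerivableS43 (insert φ Γ) ψ) : DerivableS43 Γ (φ.imp ψ) := by
  have weaken : ∀ χ, DerivableS43 Γ χ → DerivableS43 Γ (φ.imp χ) := fun χ hχ =>
    mp _ _ (thm _ (.taut _ fun t hb hi => by simp only [hi]; tauto)) hχ
  induction h with
  | hyp χ hχ =>
    rcases hχ with rfl | hχ
    · exact thm _ (.taut _ fun t hb hi => by simp only [hi]; tauto)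
    · exact weaken _ (hyp _ hχ)
  | thm χ hχ => exact weaken _ (thm _ hχ)
  | mp χ θ _ _ h₁ h₂ =>
    refine mp _ _ (mp _ _ (thm _ (.taut ((φ.imp (χ.imp θ)).imp ((φ.imp χ).imp (φ.imp θ)))
      fun t hb hi => ?_)) h₁) h₂
    simp only [hi]; tauto

/-- Compactness: a derivation uses finitely many hypotheses, and these lie in one member of the
chain. This is the chain condition for Zorn's lemma. -/
theorem exists_of_sUnion {c : Set (Set ModalProp)} (hc : IsChain (· ⊆ ·) c) (hne : c.Nonempty)
    (h : DerivableS43 (⋃₀ c) φ) : ∃ Γ ∈ c, DerivableS43 Γ φ := by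
  induction h with
  | hyp φ hφ =>
    obtain ⟨Γ, hΓ, hφ⟩ := hφ
    exact ⟨Γ, hΓ, hyp _ hφ⟩
  | thm φ hφ => exact ⟨_, hne.some_mem, thm _ hφ⟩
  | mp φ ψ _ _ h₁ h₂ =>
    obtain ⟨Γ, hΓ, h₁⟩ := h₁
    obtain ⟨Δ, hΔ, h₂⟩ := h₂
    rcases hc.total hΓ hΔ with h | h
    · exact ⟨Δ, hΔ, mp _ _ (h₁.mono h) h₂⟩
    · exact ⟨Γ, hΓ, mp _ _ h₁ (h₂.mono h)⟩

/-- A normality property: the formulas that are necessary in `Γ` have necessary consequences. -/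
theorem box (h : DerivableS43 {χ | DerivableS43 Γ χ.box} φ) : DerivableS43 Γ φ.box := by
  induction h with
  | hyp φ hφ => exact hφ
  | thm φ hφ => exact thm _ (.nec _ hφ)
  | mp φ ψ _ _ h₁ h₂ => exact mp _ _ (mp _ _ (thm _ (.axK φ ψ)) h₁) h₂

end DerivableS43

/-- Maximal consistent sets of modal formulas. -/
def IsMaxConsistent (Γ : Set ModalProp) : Prop :=
  Maximal (fun Δ => ¬ DerivableS43 Δ bot) Γ

/-- Lindenbaum's lemma: adjoining the negation of φ keeps Γ consistent, and a maximal consistent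
extension of the result cannot contain φ as well. -/
theorem exists_isMaxConsistent {Γ : Set ModalProp} {φ : ModalProp} (h : ¬ DerivableS43 Γ φ) :
    ∃ Δ, Γ ⊆ Δ ∧ IsMaxConsistent Δ ∧ φ ∉ Δ := by
  obtain ⟨Δ, hΔ, hmax⟩ := zorn_subset_nonempty {Δ | ¬ DerivableS43 Δ bot}
    (fun c hc hch hne => ⟨⋃₀ c, fun hb => by
      obtain ⟨Δ, hΔ, hb⟩ := hb.exists_of_sUnion hch hne
      exact hc hΔ hb, fun s hs => Set.subset_sUnion_of_mem hs⟩)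
    (insert φ.neg Γ) fun hb => h (.mp _ _ (.thm _ (.taut (φ.neg.neg.imp φ) fun t hb hi => by
      simp only [hi, neg]; tauto)) hb.deduction)
  refine ⟨Δ, (Set.subset_insert _ _).trans hΔ, hmax, fun hφ => hmax.1 ?_⟩
  exact .mp _ _ (.hyp _ (hΔ (Set.mem_insert _ _))) (.hyp _ hφ)

namespace IsMaxConsistent

variable {Γ Δ : Set ModalProp} {φ ψ : ModalProp}

theorem mem_iff (hΓ : IsMaxConsistent Γ) : φ ∈ Γ ↔ DerivableS43 Γ φ := by
  refine ⟨.hyp φ, fun h => ?_⟩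
  refine hΓ.2 (y := insert φ Γ) (fun hb => ?_) (Set.subset_insert _ _) (Set.mem_insert _ _)
  exact hΓ.1 (.mp _ _ hb.deduction h)

theorem bot_notMem (hΓ : IsMaxConsistent Γ) : bot ∉ Γ := fun h => hΓ.1 (.hyp _ h)

theorem mem_of_provable (hΓ : IsMaxConsistent Γ) (h : ProvableS43 φ) : φ ∈ Γ :=
  hΓ.mem_iff.2 (.thm _ h)

theorem mp_mem (hΓ : IsMaxConsistent Γ) (h : φ.imp ψ ∈ Γ) (h' : φ ∈ Γ) : ψ ∈ Γ :=
  hΓ.mem_iff.2 (.mp _ _ (.hyp _ h) (.hyp _ h'))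

theorem imp_mem_iff (hΓ : IsMaxConsistent Γ) : φ.imp ψ ∈ Γ ↔ (φ ∈ Γ → ψ ∈ Γ) := by
  refine ⟨hΓ.mp_mem, fun h => ?_⟩
  rw [hΓ.mem_iff]
  by_cases hφ : φ ∈ Γ
  · refine .mp _ _ (.thm _ (.taut (ψ.imp (φ.imp ψ)) fun t hb hi => ?_)) (.hyp _ (h hφ))
    simp only [hi]; tauto
  · have : DerivableS43 (insert φ Γ) bot := by
      by_contra hb
      exact hφ (hΓ.2 hb (Set.subset_insert _ _) (Set.mem_insert _ _))
    refine .mp _ _ (.thm _ (.taut ((φ.imp bot).imp (φ.imp ψ)) fun t hb hi => ?_)) this.deduction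
    simp only [hi]; tauto

theorem neg_mem_iff (hΓ : IsMaxConsistent Γ) : φ.neg ∈ Γ ↔ φ ∉ Γ := by
  simp only [neg, hΓ.imp_mem_iff, hΓ.bot_notMem, imp_false]

theorem and_mem_iff (hΓ : IsMaxConsistent Γ) : φ.and ψ ∈ Γ ↔ φ ∈ Γ ∧ ψ ∈ Γ := by
  simp only [ModalProp.and, hΓ.neg_mem_iff, hΓ.imp_mem_iff]; tauto

theorem or_mem_iff (hΓ : IsMaxConsistent Γ) : φ.or ψ ∈ Γ ↔ φ ∈ Γ ∨ ψ ∈ Γ := by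
  simp only [ModalProp.or, hΓ.neg_mem_iff, hΓ.imp_mem_iff]; tauto

end IsMaxConsistent

/-- The accessibility relation of the canonical model. -/
def CanonicalAcc (Γ Δ : Set ModalProp) : Prop := ∀ φ : ModalProp, φ.box ∈ Γ → φ ∈ Δ

namespace IsMaxConsistent

variable {Γ Δ Θ : Set ModalProp} {φ ψ : ModalProp}

theorem canonicalAcc_refl (hΓ : IsMaxConsistent Γ) : CanonicalAcc Γ Γ := fun φ h =>
  hΓ.mp_mem (hΓ.mem_of_provable (.axT φ)) h

theorem canonicalAcc_trans (hΓ : IsMaxConsistent Γ) (h : CanonicalAcc Γ Δ)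
    (h' : CanonicalAcc Δ Θ) : CanonicalAcc Γ Θ := fun φ hφ =>
  h' _ (h _ (hΓ.mp_mem (hΓ.mem_of_provable (.ax4 φ)) hφ))

theorem box_mem_of_canonicalAcc (hΓ : IsMaxConsistent Γ) (h : CanonicalAcc Γ Δ)
    (hφ : φ.box ∈ Γ) : φ.box ∈ Δ :=
  h _ (hΓ.mp_mem (hΓ.mem_of_provable (.ax4 φ)) hφ)

/-- By normality the formulas necessary in Γ do not derive φ, so Lindenbaum's lemma extends them to
a successor that omits φ. -/
theorem exists_notMem_of_box_notMem (hΓ : IsMaxConsistent Γ) (h : φ.box ∉ Γ) :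
    ∃ Δ, IsMaxConsistent Δ ∧ CanonicalAcc Γ Δ ∧ φ ∉ Δ := by
  rw [hΓ.mem_iff] at h
  obtain ⟨Δ, hΓΔ, hΔ, hφ⟩ := exists_isMaxConsistent (mt DerivableS43.box h)
  exact ⟨Δ, hΔ, fun χ hχ => hΓΔ (.hyp _ hχ), hφ⟩

theorem dia_mem_iff (hΓ : IsMaxConsistent Γ) :
    φ.dia ∈ Γ ↔ ∃ Δ, IsMaxConsistent Δ ∧ CanonicalAcc Γ Δ ∧ φ ∈ Δ := by
  rw [dia, hΓ.neg_mem_iff]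
  constructor
  · intro h
    obtain ⟨Δ, hΔ, hΓΔ, hφ⟩ := hΓ.exists_notMem_of_box_notMem h
    exact ⟨Δ, hΔ, hΓΔ, by rwa [hΔ.neg_mem_iff, not_not] at hφ⟩
  · rintro ⟨Δ, hΔ, hΓΔ, hφ⟩ h
    exact hΔ.neg_mem_iff.1 (hΓΔ _ h) hφ

/-- The canonical model of S4.3 is forward connected. -/
theorem canonicalAcc_total (hΓ : IsMaxConsistent Γ) (hΔ : IsMaxConsistent Δ)
    (hΘ : IsMaxConsistent Θ) (h₁ : CanonicalAcc Γ Δ) (h₂ : CanonicalAcc Γ Θ) :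
    CanonicalAcc Δ Θ ∨ CanonicalAcc Θ Δ := by
  by_contra! h
  simp only [CanonicalAcc, not_forall] at h
  obtain ⟨⟨a, ha, ha'⟩, b, hb, hb'⟩ := h
  -- Axiom .3 for these two formulas yields a Ξ that contains one of them and sees the other; but □a
  -- in Ξ excludes a successor with ¬a, and likewise for b.
  have hp : a.box.and b.neg ∈ Δ := hΔ.and_mem_iff.2 ⟨ha, hΔ.neg_mem_iff.2 hb'⟩
  have hq : b.box.and a.neg ∈ Θ := hΘ.and_mem_iff.2 ⟨hb, hΘ.neg_mem_iff.2 ha'⟩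
  have h3 := hΓ.mp_mem (hΓ.mem_of_provable (.ax3 (a.box.and b.neg) (b.box.and a.neg)))
    (hΓ.and_mem_iff.2 ⟨hΓ.dia_mem_iff.2 ⟨Δ, hΔ, h₁, hp⟩, hΓ.dia_mem_iff.2 ⟨Θ, hΘ, h₂, hq⟩⟩)
  obtain ⟨Ξ, hΞ, -, h⟩ := hΓ.dia_mem_iff.1 h3
  have key : ∀ c d : ModalProp, c.box.and d.neg ∈ Ξ → (d.box.and c.neg).dia ∉ Ξ := by
    intro c d hcd h'
    obtain ⟨Ψ, hΨ, hΞΨ, h''⟩ := hΞ.dia_mem_iff.1 h'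
    exact hΨ.neg_mem_iff.1 (hΨ.and_mem_iff.1 h'').2 (hΞΨ _ (hΞ.and_mem_iff.1 hcd).1)
  rcases hΞ.or_mem_iff.1 h with h | h
  · exact key a b (hΞ.and_mem_iff.1 h).1 (hΞ.and_mem_iff.1 h).2
  · exact key b a (hΞ.and_mem_iff.1 h).1 (hΞ.and_mem_iff.1 h).2

end IsMaxConsistent

/-! ### The finite model property -/

namespace ModalProp

/-- The set of subformulas of a modal formula. -/
def subformulas : ModalProp → Set ModalProp
  | var i => {var i}
  | bot => {bot}
  | imp φ ψ => insert (imp φ ψ) (φ.subformulas ∪ ψ.subformulas)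
  | box φ => insert (box φ) φ.subformulas

theorem finite_subformulas (φ : ModalProp) : φ.subformulas.Finite := by
  induction φ with
  | var i => exact Set.finite_singleton _
  | bot => exact Set.finite_singleton _
  | imp φ ψ h₁ h₂ => exact (h₁.union h₂).insert _
  | box φ h => exact h.insert _

theorem self_mem_subformulas (φ : ModalProp) : φ ∈ φ.subformulas := by
  cases φ <;> simp [subformulas]

end ModalProp

/-- The transitive filtration, through the set `S` of formulas, of the canonical relation. -/
def FiltrationAcc (S Γ Δ : Set ModalProp) : Prop :=
  ∀ φ : ModalProp, φ.box ∈ S → φ.box ∈ Γ → φ.box ∈ Δ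

/-- Truth in the filtration of a generated part of the canonical model is membership. -/
theorem sat_filtration_iff {ι : Type*} {S Γ : Set ModalProp} (hΓ : IsMaxConsistent Γ)
    (D : ι → Set ModalProp) (hD : ∀ i, IsMaxConsistent (D i)) (hΓD : ∀ i, CanonicalAcc Γ (D i))
    (hsurj : ∀ Δ, IsMaxConsistent Δ → CanonicalAcc Γ Δ → ∃ i, ∀ φ ∈ S, φ ∈ Δ ↔ φ ∈ D i)
    (φ : ModalProp) (hφ : φ.subformulas ⊆ S) :
    ∀ i, Sat (fun i j => FiltrationAcc S (D i) (D j)) (fun p i => var p ∈ D i) φ i ↔ φ ∈ D i := by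
  induction φ with
  | var p => exact fun _ => Iff.rfl
  | bot => exact fun i => iff_of_false id (hD i).bot_notMem
  | imp φ ψ h₁ h₂ =>
    simp only [subformulas, Set.insert_subset_iff, Set.union_subset_iff] at hφ
    intro i
    rw [(hD i).imp_mem_iff, ← h₁ hφ.2.1, ← h₂ hφ.2.2, Sat]
  | box φ ih =>
    simp only [subformulas, Set.insert_subset_iff] at hφ
    intro i
    constructor
    · intro h
      by_contra hn
      obtain ⟨Δ, hΔ, hDΔ, hφΔ⟩ := (hD i).exists_notMem_of_box_notMem hn
      -- The canonical successor need not be among the chosen sets; it is replaced by one that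
      -- agrees with it on `S`.
      obtain ⟨j, hj⟩ := hsurj Δ hΔ (hΓ.canonicalAcc_trans (hΓD i) hDΔ)
      refine hφΔ ((hj φ (hφ.2 φ.self_mem_subformulas)).2 ((ih hφ.2 j).1 (h j ?_)))
      exact fun ψ hψ hψi => (hj _ hψ).1 ((hD i).box_mem_of_canonicalAcc hDΔ hψi)
    -- The filtration relation only carries boxed formulas along; axiom T at `D j` removes the box.
    · exact fun h j hij => (ih hφ.2 j).2 ((hD j).canonicalAcc_refl _ (hij φ hφ.1 h))

/-- The finite model property: every modal formula that S4.3 does not prove fails at the first point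
of a finite linear preorder. -/
theorem exists_not_sat_of_not_provableS43 {φ : ModalProp} (h : ¬ ProvableS43 φ) :
    ∃ (n : ℕ) (R : Fin (n + 1) → Fin (n + 1) → Prop) (V : ℕ → Fin (n + 1) → Prop),
      (∀ i j k, R i j → R j k → R i k) ∧ (∀ i j, i ≤ j → R i j) ∧ ¬ Sat R V φ 0 := by
  classical
  set S := φ.subformulas with hS
  obtain ⟨Γ, -, hΓ, hφ⟩ := exists_isMaxConsistent (mt DerivableS43.provable h)
  let C : Set (Set ModalProp) := {Δ | IsMaxConsistent Δ ∧ CanonicalAcc Γ Δ}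
  have hfin : ((fun Δ => S ∩ Δ) '' C).Finite :=
    φ.finite_subformulas.finite_subsets.subset (by rintro _ ⟨Δ, -, rfl⟩; exact Set.inter_subset_left)
  -- One representative for each of the finitely many traces on the subformulas.
  obtain ⟨T, hTC, hT⟩ := Set.exists_subset_bijOn C (fun Δ => S ∩ Δ)
  have hTfin : T.Finite := (hT.image_eq ▸ hfin).of_finite_image hT.injOn
  have htotal : ∀ Δ ∈ C, ∀ Θ ∈ C, FiltrationAcc S Δ Θ ∨ FiltrationAcc S Θ Δ := by
    intro Δ hΔ Θ hΘ
    exact (hΓ.canonicalAcc_total hΔ.1 hΘ.1 hΔ.2 hΘ.2).imp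
      (fun h φ _ => hΔ.1.box_mem_of_canonicalAcc h) fun h φ _ => hΘ.1.box_mem_of_canonicalAcc h
  let r : C → C → Prop := fun a b => FiltrationAcc S a b
  have : Std.Total r := ⟨fun a b => htotal a a.2 b b.2⟩
  have : IsTrans C r := ⟨fun a b c hab hbc ψ hψ h => hbc ψ hψ (hab ψ hψ h)⟩
  let Γ₀ : C := ⟨Γ, hΓ, hΓ.canonicalAcc_refl⟩
  have hTfin' : ((↑) ⁻¹' T : Set C).Finite := hTfin.preimage Subtype.val_injective.injOn
  -- `Γ₀` accesses every member of `C`, so it may head the sorted list and become point 0. Its trace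
  -- then occurs twice, which is harmless, since points are positions in the list.
  let l : List C := Γ₀ :: List.insertionSort r hTfin'.toFinset.toList
  have hl : l.Pairwise r := List.pairwise_cons.2
    ⟨fun b _ ψ _ h => hΓ.box_mem_of_canonicalAcc b.2.2 h, List.pairwise_insertionSort r _⟩
  have hmem : ∀ Δ ∈ C, ∃ i : Fin l.length, ∀ ψ ∈ S, ψ ∈ Δ ↔ ψ ∈ (l.get i).1 := by
    intro Δ hΔ
    obtain ⟨Θ, hΘ, he⟩ := hT.surjOn ⟨Δ, hΔ, rfl⟩
    have : (⟨Θ, hTC hΘ⟩ : C) ∈ l := by simp [l, hΘ]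
    obtain ⟨i, hi⟩ := List.get_of_mem this
    refine ⟨i, fun ψ hψ => ?_⟩
    have := Set.ext_iff.1 he ψ
    simp only [Set.mem_inter_iff, hψ, true_and] at this
    rw [hi, this]
  refine ⟨(List.insertionSort r hTfin'.toFinset.toList).length,
    fun i j => FiltrationAcc S (l.get i).1 (l.get j).1, fun p i => var p ∈ (l.get i).1,
    fun i j k hij hjk ψ hψ h => hjk ψ hψ (hij ψ hψ h), fun i j hij => ?_, ?_⟩
  · rcases hij.eq_or_lt with rfl | hij
    · exact fun _ _ h => h
    · exact List.pairwise_iff_get.1 hl i j hij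
  · exact fun h => hφ ((sat_filtration_iff hΓ (fun i => (l.get i).1) (fun i => (l.get i).2.1)
      (fun i => (l.get i).2.2) (fun Δ h h' => hmem Δ ⟨h, h'⟩) φ hS.ge 0).1 h)

/-! ### Sets of hereditary limit rank -/

/-- A first-order property of sets that bounds how divisible the rank is: it implies that `ω ^ j`
divides the rank, and for the sets `V_α` it is equivalent to that. -/
def LimitLike : ℕ → ZFSet.{u} → Prop
  | 0, _ => True
  | j + 1, a => ∀ b ∈ a, ∃ c ∈ a, b ∈ c ∧ LimitLike j c

open Ordinal Order in
-- The multiples of ω^(j+1) are 0 and the limits of multiples of ω^j.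
theorem Ordinal.omega0_pow_succ_dvd_iff {j : ℕ} {α : Ordinal.{u}} :
    ω ^ (j + 1) ∣ α ↔ ∀ β < α, ∃ γ < α, β < γ ∧ ω ^ j ∣ γ := by
  have h0 : (ω : Ordinal.{u}) ^ j ≠ 0 := pow_ne_zero _ omega0_ne_zero
  constructor
  · rintro ⟨q, rfl⟩ β hβ
    rw [pow_succ, mul_assoc] at hβ ⊢
    rcases eq_or_ne q 0 with rfl | hq
    · simp at hβ
    have hlim : IsSuccLimit (ω * q) :=
      isSuccLimit_iff.2 ⟨mul_ne_zero omega0_ne_zero hq,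
        isSuccPrelimit_iff_omega0_dvd.2 (dvd_mul_right _ _)⟩
    have hdiv : β / ω ^ j < ω * q := (lt_mul_iff_div_lt h0).1 hβ
    -- The next multiple of ω^j after β; it stays below α because the quotient of α by ω^j is a
    -- limit.
    refine ⟨ω ^ j * (β / ω ^ j + 1), ?_, ?_, dvd_mul_right _ _⟩
    · exact mul_lt_mul_of_pos_left (hlim.succ_lt hdiv) (pos_iff_ne_zero.2 h0)
    · rw [mul_add_one]
      exact lt_mul_div_add _ h0
  · intro h
    have hmod : α % ω ^ j = 0 := by
      by_contra hr
      -- With a nonzero remainder this is the last multiple of ω^j below α, so no γ can exceed it.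
      obtain ⟨γ, hγ, hlt, c, rfl⟩ := h (ω ^ j * (α / ω ^ j)) (by
        conv_rhs => rw [← div_add_mod α (ω ^ j)]
        exact lt_add_of_pos_right _ (pos_iff_ne_zero.2 hr))
      have h1 := lt_of_mul_lt_mul_left' hlt
      exact absurd h1 (not_lt.2 ((mul_le_iff_le_div h0).1 hγ.le))
    obtain ⟨q, rfl⟩ := dvd_of_mod_eq_zero hmod
    rw [pow_succ]
    refine mul_dvd_mul_left _ (isSuccPrelimit_iff_omega0_dvd.1 ?_)
    intro p hp
    have hq : q = p + 1 := hp.succ_eq.symm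
    subst hq
    obtain ⟨γ, hγ, hlt, c, rfl⟩ := h (ω ^ j * p)
      (mul_lt_mul_of_pos_left (lt_add_one p) (pos_iff_ne_zero.2 h0))
    have h1 := lt_of_mul_lt_mul_left' hlt
    have h2 := lt_of_mul_lt_mul_left' hγ
    exact absurd (lt_add_one_iff.1 h2) (not_le.2 h1)

open Ordinal in
-- The ranks of the `LimitLike j` elements are multiples of ω^j, by induction, and they are cofinal
-- in the rank of `a`.
theorem LimitLike.dvd_rank {j : ℕ} {a : ZFSet.{u}} (h : LimitLike j a) : ω ^ j ∣ a.rank := by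
  induction j generalizing a with
  | zero => simp
  | succ j ih =>
    rw [omega0_pow_succ_dvd_iff]
    intro β hβ
    obtain ⟨b, hb, hβb⟩ := ZFSet.lt_rank_iff.1 hβ
    obtain ⟨c, hc, hbc, hj⟩ := h b hb
    exact ⟨c.rank, ZFSet.rank_lt_of_mem hc, hβb.trans_lt (ZFSet.rank_lt_of_mem hbc), ih hj⟩

open Ordinal in
theorem limitLike_vonNeumann_iff {j : ℕ} {α : Ordinal.{u}} :
    LimitLike j (ZFSet.vonNeumann α) ↔ ω ^ j ∣ α := by
  refine ⟨fun h => by simpa using h.dvd_rank, fun h => ?_⟩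
  induction j generalizing α with
  | zero => trivial
  | succ j ih =>
    intro b hb
    obtain ⟨γ, hγ, hlt, hd⟩ := omega0_pow_succ_dvd_iff.1 h _ (ZFSet.mem_vonNeumann.1 hb)
    exact ⟨ZFSet.vonNeumann γ, by simpa using hγ, ZFSet.mem_vonNeumann.2 hlt, ih hd⟩

open Ordinal in
-- The witness is `V_α` for α = ω^k, an element of `V_β` if β > α and `V_β` itself if β = α.
-- Nonemptiness is required because the empty set is `LimitLike k` for every k.
theorem omega0_pow_le_iff {k : ℕ} {β : Ordinal.{u}} :
    ω ^ k ≤ β ↔ (∃ a ∈ ZFSet.vonNeumann β, (∃ b, b ∈ a) ∧ LimitLike k a) ∨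
      ((∃ b, b ∈ ZFSet.vonNeumann β) ∧ LimitLike k (ZFSet.vonNeumann β)) := by
  have hpos : (0 : Ordinal.{u}) < ω ^ k := pos_iff_ne_zero.2 (pow_ne_zero _ omega0_ne_zero)
  have hne : ∀ γ : Ordinal.{u}, 0 < γ → ∃ b, b ∈ ZFSet.vonNeumann γ := fun γ hγ =>
    ⟨∅, ZFSet.mem_vonNeumann.2 (by simpa using hγ)⟩
  have hrank : ∀ a : ZFSet.{u}, (∃ b, b ∈ a) → LimitLike k a → ω ^ k ≤ a.rank := by
    rintro a ⟨b, hb⟩ h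
    exact le_of_dvd (zero_le.trans_lt (ZFSet.rank_lt_of_mem hb)).ne' h.dvd_rank
  constructor
  · intro h
    rcases h.eq_or_lt with rfl | h
    · exact .inr ⟨hne _ hpos, limitLike_vonNeumann_iff.2 dvd_rfl⟩
    · exact .inl ⟨ZFSet.vonNeumann (ω ^ k), by simpa using h, hne _ hpos,
        limitLike_vonNeumann_iff.2 dvd_rfl⟩
  · rintro (⟨a, ha, hb, h⟩ | ⟨hb, h⟩)
    · exact (hrank a hb h).trans (ZFSet.mem_vonNeumann.1 ha).le
    · simpa using hrank _ hb h

/-! ### Definability by sentences of the language of set theory -/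

open FirstOrder.Language

/-- The formula `xᵢ ∈ xⱼ`. -/
def memFormula {n : ℕ} (i j : Fin n) : setLang.BoundedFormula Empty n :=
  Relations.boundedFormula (L := setLang) SetMemRel.mem ![Term.var (.inr i), Term.var (.inr j)]

@[simp]
theorem realize_memFormula {n : ℕ} {i j : Fin n} {β : Ordinal.{u}} {e : Empty → vStage β}
    {xs : Fin n → vStage β} :
    (memFormula i j).Realize e xs ↔ (xs i : ZFSet.{u}) ∈ (xs j : ZFSet.{u}) := Iff.rfl

/-- The formula expressing that `xᵢ` satisfies `LimitLike j`. -/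
def limitLikeFormula : ℕ → (n : ℕ) → Fin n → setLang.BoundedFormula Empty n
  | 0, _, _ => ⊤
  | j + 1, n, i => BoundedFormula.all ((memFormula (Fin.last n) i.castSucc).imp
      (BoundedFormula.ex (memFormula (Fin.last (n + 1)) i.castSucc.castSucc ⊓
        (memFormula (Fin.last n).castSucc (Fin.last (n + 1)) ⊓
          limitLikeFormula j (n + 2) (Fin.last (n + 1))))))

theorem mem_vStage_of_mem {β : Ordinal.{u}} {a b : ZFSet.{u}} (ha : a ∈ vStage β) (hb : b ∈ a) :
    b ∈ vStage β :=
  ZFSet.isTransitive_vonNeumann β a ha hb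

/-- All quantifiers are bounded, so the formula is absolute for the transitive set `V_β`. -/
theorem realize_limitLikeFormula {j n : ℕ} {i : Fin n} {β : Ordinal.{u}} {e : Empty → vStage β}
    {xs : Fin n → vStage β} :
    (limitLikeFormula j n i).Realize e xs ↔ LimitLike j (xs i : ZFSet.{u}) := by
  induction j generalizing n with
  | zero => simp [limitLikeFormula, LimitLike]
  | succ j ih =>
    simp only [limitLikeFormula, LimitLike, BoundedFormula.realize_all, BoundedFormula.realize_imp,
      BoundedFormula.realize_ex, BoundedFormula.realize_inf, realize_memFormula, ih,
      Fin.snoc_last, Fin.snoc_castSucc]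
    constructor
    · intro h b hb
      obtain ⟨c, h⟩ := h ⟨b, mem_vStage_of_mem (xs i).2 hb⟩ hb
      exact ⟨c, h⟩
    · intro h b hb
      obtain ⟨c, hc, h⟩ := h b hb
      exact ⟨⟨c, mem_vStage_of_mem (xs i).2 hc⟩, hc, h⟩

/-- A property of ordinals is first-order if some sentence of the language of set theory expresses
it, at `V_β` about `β`. -/
def FirstOrderProperty (P : Ordinal.{u} → Prop) : Prop :=
  ∃ σ : setLang.Sentence, ∀ β, (vStage β) ⊨ σ ↔ P β

namespace FirstOrderProperty

variable {P Q : Ordinal.{u} → Prop}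

theorem const (p : Prop) : FirstOrderProperty fun _ : Ordinal.{u} => p := by
  by_cases hp : p
  · exact ⟨⊤, fun β => by simp [Sentence.Realize, Formula.Realize, hp]⟩
  · exact ⟨⊥, fun β => by simp [Sentence.Realize, Formula.Realize, hp]⟩

theorem not (hP : FirstOrderProperty P) : FirstOrderProperty fun β => ¬ P β := by
  obtain ⟨σ, hσ⟩ := hP
  exact ⟨∼σ, fun β => (Sentence.realize_not _).trans (not_congr (hσ β))⟩

theorem and (hP : FirstOrderProperty P) (hQ : FirstOrderProperty Q) :
    FirstOrderProperty fun β => P β ∧ Q β := by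
  obtain ⟨σ, hσ⟩ := hP
  obtain ⟨τ, hτ⟩ := hQ
  exact ⟨σ ⊓ τ, fun β => Formula.realize_inf.trans (and_congr (hσ β) (hτ β))⟩

theorem or (hP : FirstOrderProperty P) (hQ : FirstOrderProperty Q) :
    FirstOrderProperty fun β => P β ∨ Q β := by
  simpa only [not_and_or, not_not] using (hP.not.and hQ.not).not

theorem exists_fin {n : ℕ} {P : Fin n → Ordinal.{u} → Prop} (h : ∀ i, FirstOrderProperty (P i)) :
    FirstOrderProperty fun β => ∃ i, P i β := by
  induction n with
  | zero => simpa using const False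
  | succ n ih =>
    simp only [Fin.exists_fin_succ]
    exact (h 0).or (ih fun i => h i.succ)

theorem findGreatest_eq {P : ℕ → Ordinal.{u} → Prop} [∀ β, DecidablePred fun i => P i β]
    (h : ∀ i, FirstOrderProperty (P i)) (n k : ℕ) :
    FirstOrderProperty fun β => Nat.findGreatest (fun i => P i β) n = k := by
  induction n with
  | zero => simpa using const _
  | succ n ih =>
    have : (fun β => Nat.findGreatest (fun i => P i β) (n + 1) = k) = fun β =>
        (P (n + 1) β ∧ n + 1 = k) ∨ (¬ P (n + 1) β ∧ Nat.findGreatest (fun i => P i β) n = k) := by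
      ext β
      rw [Nat.findGreatest_succ]
      split_ifs with hP <;> simp [hP]
    rw [this]
    exact ((h _).and (const _)).or ((h _).not.and ih)

open Ordinal

/-- `V_β` is not an element of itself, so the two outer quantifiers are taken over the whole
structure instead of being bounded by a variable. -/
theorem limitLike (j : ℕ) : FirstOrderProperty fun β : Ordinal.{u} =>
    LimitLike j (ZFSet.vonNeumann β) := by
  cases j with
  | zero => exact const True
  | succ j =>
    refine ⟨BoundedFormula.all (BoundedFormula.ex
      (memFormula 0 1 ⊓ limitLikeFormula j 2 1)), fun β => ?_⟩
    simp only [Sentence.Realize, Formula.Realize, BoundedFormula.realize_all,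
      BoundedFormula.realize_ex, BoundedFormula.realize_inf, realize_memFormula,
      realize_limitLikeFormula, LimitLike, Subtype.forall, Subtype.exists]
    exact forall_congr' fun b => forall_congr' fun hb => exists_congr fun c =>
      ⟨fun ⟨hc, h⟩ => ⟨hc, h⟩, fun ⟨hc, h⟩ => ⟨hc, h⟩⟩

theorem omega0_pow_dvd (j : ℕ) : FirstOrderProperty fun β : Ordinal.{u} => ω ^ j ∣ β := by
  simpa only [limitLike_vonNeumann_iff] using limitLike j

theorem omega0_pow_le (k : ℕ) : FirstOrderProperty fun β : Ordinal.{u} => ω ^ k ≤ β := by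
  simp only [omega0_pow_le_iff]
  refine or ?_ (and ?_ (limitLike k))
  · refine ⟨BoundedFormula.ex (BoundedFormula.ex (memFormula 1 0) ⊓ limitLikeFormula k 1 0),
      fun β => ?_⟩
    simp only [Sentence.Realize, Formula.Realize, BoundedFormula.realize_ex,
      BoundedFormula.realize_inf, realize_memFormula, realize_limitLikeFormula]
    constructor
    · rintro ⟨a, ⟨b, hb⟩, h⟩
      exact ⟨a, a.2, ⟨b, hb⟩, h⟩
    · rintro ⟨a, ha, ⟨b, hb⟩, h⟩
      exact ⟨⟨a, ha⟩, ⟨⟨b, mem_vStage_of_mem ha hb⟩, hb⟩, h⟩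
  · refine ⟨BoundedFormula.ex ⊤, fun β => ?_⟩
    simp only [Sentence.Realize, Formula.Realize, BoundedFormula.realize_ex,
      BoundedFormula.realize_top]
    exact ⟨fun ⟨a, _⟩ => ⟨a, a.2⟩, fun ⟨a, ha⟩ => ⟨⟨a, ha⟩, trivial⟩⟩

end FirstOrderProperty

/-! ### The ordinals as a modal frame -/

section OrdinalFrame

open Ordinal

open Classical in
/-- The number `i ≤ n` of the interval `[ω ^ (n + 1 + i), ω ^ (n + 1 + i + 1))` that contains `β`,
where the first and the last interval are extended to all smaller and larger ordinals. -/
noncomputable def ordinalRegion (n : ℕ) (β : Ordinal.{u}) : ℕ :=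
  Nat.findGreatest (fun i => ω ^ (n + 1 + i) ≤ β) n

noncomputable instance decidablePredOmega0PowDvd (β : Ordinal.{u}) :
    DecidablePred fun j : ℕ => ω ^ j ∣ β :=
  Classical.decPred _

/-- The greatest `j ≤ n` such that `ω ^ j` divides `β`. -/
noncomputable def ordinalSwitch (n : ℕ) (β : Ordinal.{u}) : ℕ :=
  Nat.findGreatest (fun j : ℕ => ω ^ j ∣ β) n

theorem ordinalRegion_le (n : ℕ) (β : Ordinal.{u}) : ordinalRegion n β ≤ n :=
  Nat.findGreatest_le _

theorem ordinalSwitch_le (n : ℕ) (β : Ordinal.{u}) : ordinalSwitch n β ≤ n :=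
  Nat.findGreatest_le _

theorem ordinalRegion_mono (n : ℕ) : Monotone (ordinalRegion.{u} n) := fun _ _ h =>
  Nat.findGreatest_mono_left (fun _ h' => h'.trans h) n

theorem ordinalRegion_one (n : ℕ) : ordinalRegion n (1 : Ordinal.{u}) = 0 := by
  refine Nat.findGreatest_eq_zero_iff.2 fun i _ _ h => ?_
  exact absurd h (not_le.2 (one_lt_pow₀ one_lt_omega0 (by omega)))

/-- This fails at 0, which every power of ω divides; hence the choice of the world `V_1`. -/
theorem ordinalSwitch_one (n : ℕ) : ordinalSwitch n (1 : Ordinal.{u}) = 0 := by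
  refine Nat.findGreatest_eq_zero_iff.2 fun i hi _ h => ?_
  exact absurd (le_of_dvd one_ne_zero h) (not_le.2 (one_lt_pow₀ one_lt_omega0 hi.ne'))

theorem Ordinal.add_lt_omega0_pow {k : ℕ} {α β : Ordinal.{u}} (hα : α < ω ^ k) (hβ : β < ω ^ k) :
    α + β < ω ^ k := by
  rw [← opow_natCast] at *
  exact isPrincipal_add_omega0_opow k hα hβ

/-- Above every ordinal of a region, every later region has ordinals with any given switch. -/
theorem exists_ordinalRegion_ordinalSwitch_eq {n i j : ℕ} (hi : i ≤ n) (hj : j ≤ n)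
    {β : Ordinal.{u}} (hβ : ordinalRegion n β ≤ i) :
    ∃ δ, β ≤ δ ∧ ordinalRegion n δ = i ∧ ordinalSwitch n δ = j := by
  have hlt : ∀ {k l : ℕ}, k < l → (ω : Ordinal.{u}) ^ k < ω ^ l := fun h =>
    pow_lt_pow_right₀ one_lt_omega0 h
  set α := max β (ω ^ (n + 1 + i)) with hα
  have h0 : (ω : Ordinal.{u}) ^ j ≠ 0 := pow_ne_zero _ omega0_ne_zero
  -- The next multiple of ω^j after α. Its quotient by ω^j is a successor, so ω^(j+1) does not
  -- divide it.
  set δ := ω ^ j * (α / ω ^ j + 1) with hδ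
  have hαδ : α ≤ δ := by
    rw [hδ, mul_add_one]
    exact (lt_mul_div_add _ h0).le
  have hδα : δ ≤ α + ω ^ j := by
    rw [hδ, mul_add_one]
    gcongr
    exact mul_div_le _ _
  refine ⟨δ, (le_max_left _ _).trans hαδ, ?_, ?_⟩
  · refine Nat.findGreatest_eq_iff.2 ⟨hi, fun _ => (le_max_right _ _).trans hαδ, ?_⟩
    intro k hik hkn h
    have hβk : β < ω ^ (n + 1 + k) := not_le.1
      (Nat.findGreatest_is_greatest (P := fun i => ω ^ (n + 1 + i) ≤ β) (hβ.trans_lt hik) hkn)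
    -- Powers of ω are closed under addition, and j ≤ n lies below all threshold exponents, so
    -- adding ω^j crosses no further threshold.
    refine absurd (h.trans hδα) (not_le.2 (add_lt_omega0_pow (max_lt hβk (hlt ?_)) (hlt ?_))) <;>
      omega
  · refine Nat.findGreatest_eq_iff.2 ⟨hj, fun _ => dvd_mul_right _ _, fun k hjk _ h => ?_⟩
    have h' : ω ^ (j + 1) ∣ δ := (pow_dvd_pow _ hjk).trans h
    rw [hδ, pow_succ] at h'
    obtain ⟨c, hc⟩ := h'
    rw [mul_assoc] at hc
    have hc' := mul_left_cancel₀ h0 hc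
    have := Ordinal.isSuccPrelimit_iff_omega0_dvd.2 ⟨c, hc'⟩
    exact this _ (Order.covBy_add_one _)

open Classical in
/-- A map of the ordinals to a finite linear preorder: the region of an ordinal chooses a cluster,
and its switch an element of that cluster. -/
noncomputable def ordinalToFin {n : ℕ} (R : Fin (n + 1) → Fin (n + 1) → Prop) (β : Ordinal.{u}) :
    Fin (n + 1) :=
  let i : Fin (n + 1) := ⟨ordinalRegion n β, Nat.lt_succ_of_le (ordinalRegion_le n β)⟩
  let j : Fin (n + 1) := ⟨ordinalSwitch n β, Nat.lt_succ_of_le (ordinalSwitch_le n β)⟩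
  -- The fallback to `i` keeps the whole region inside the cluster of `i`.
  if R i j ∧ R j i then j else i

variable {n : ℕ} {R : Fin (n + 1) → Fin (n + 1) → Prop}

theorem ordinalToFin_one : ordinalToFin R (1 : Ordinal.{u}) = 0 := by
  simp [ordinalToFin, ordinalRegion_one, ordinalSwitch_one]

theorem ordinalToFin_cluster (hle : ∀ i j, i ≤ j → R i j) (β : Ordinal.{u}) :
    R (ordinalToFin R β) ⟨ordinalRegion n β, Nat.lt_succ_of_le (ordinalRegion_le n β)⟩ ∧
      R ⟨ordinalRegion n β, Nat.lt_succ_of_le (ordinalRegion_le n β)⟩ (ordinalToFin R β) := by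
  simp only [ordinalToFin]
  split_ifs with h
  · exact ⟨h.2, h.1⟩
  · exact ⟨hle _ _ le_rfl, hle _ _ le_rfl⟩

theorem ordinalToFin_forth (htrans : ∀ i j k, R i j → R j k → R i k) (hle : ∀ i j, i ≤ j → R i j)
    {β δ : Ordinal.{u}} (h : β ≤ δ) : R (ordinalToFin R β) (ordinalToFin R δ) :=
  htrans _ _ _ (ordinalToFin_cluster hle β).1
    (htrans _ _ _ (hle _ _ (ordinalRegion_mono n h)) (ordinalToFin_cluster hle δ).2)

/-- A point `k` with index at or beyond the current region is reached in region `k` with switch `k`.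
A point with smaller or equal index that is still accessible lies in the cluster of the current
region, so changing the switch to `k` within the region suffices. -/
theorem ordinalToFin_back (htrans : ∀ i j k, R i j → R j k → R i k) (hle : ∀ i j, i ≤ j → R i j)
    {β : Ordinal.{u}} {k : Fin (n + 1)} (h : R (ordinalToFin R β) k) :
    ∃ δ, β ≤ δ ∧ ordinalToFin R δ = k := by
  have hk : R ⟨ordinalRegion n β, Nat.lt_succ_of_le (ordinalRegion_le n β)⟩ k :=
    htrans _ _ _ (ordinalToFin_cluster hle β).2 h
  rcases le_total (ordinalRegion n β) k with hik | hki
  · obtain ⟨δ, hδ, hr, hs⟩ := exists_ordinalRegion_ordinalSwitch_eq (Nat.le_of_lt_succ k.2)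
      (Nat.le_of_lt_succ k.2) hik
    exact ⟨δ, hδ, by simp [ordinalToFin, hr, hs]⟩
  · obtain ⟨δ, hδ, hr, hs⟩ := exists_ordinalRegion_ordinalSwitch_eq (ordinalRegion_le n β)
      (Nat.le_of_lt_succ k.2) le_rfl
    refine ⟨δ, hδ, ?_⟩
    have hk' : R k ⟨ordinalRegion n β, Nat.lt_succ_of_le (ordinalRegion_le n β)⟩ := hle _ _ hki
    simp [ordinalToFin, hr, hs, hk, hk']

/-- The value depends only on region and switch, so the property is a finite disjunction over pairs
of definable conditions. -/
theorem firstOrderProperty_ordinalToFin (R : Fin (n + 1) → Fin (n + 1) → Prop)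
    (P : Fin (n + 1) → Prop) :
    FirstOrderProperty fun β : Ordinal.{u} => P (ordinalToFin R β) := by
  classical
  let e (i j : Fin (n + 1)) : Fin (n + 1) := if R i j ∧ R j i then j else i
  have : (fun β : Ordinal.{u} => P (ordinalToFin R β)) = fun β => ∃ i j : Fin (n + 1),
      ordinalRegion n β = i ∧ ordinalSwitch n β = j ∧ P (e i j) := by
    ext β
    constructor
    · exact fun h => ⟨⟨_, Nat.lt_succ_of_le (ordinalRegion_le n β)⟩,
        ⟨_, Nat.lt_succ_of_le (ordinalSwitch_le n β)⟩, rfl, rfl, by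
          simp only [ordinalToFin] at h; convert h⟩
    · rintro ⟨⟨i, hi⟩, ⟨j, hj⟩, rfl, rfl, h⟩
      simp only [ordinalToFin]
      convert h
  rw [this]
  exact .exists_fin fun i => .exists_fin fun j =>
    .and (.findGreatest_eq (fun i => .omega0_pow_le (n + 1 + i)) n i)
      (.and (.findGreatest_eq (fun j => .omega0_pow_dvd j) n j) (.const _))

end OrdinalFrame

/-! ### Validities of potentialist systems -/

namespace PotFormula

variable {L : FirstOrder.Language.{u, v}} {M : Type w} {α : Type x}

theorem realize_ofBounded (S : PotentialistSystem.{u, v, w, y, z} L M) {α' : Type*} (g : α' → α)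
    {n : ℕ} (f : L.BoundedFormula α' n) {W : S.World} (a : α → S.dom W) (xs : Fin n → S.dom W) :
    (ofBounded g f : PotFormula L M α n).Realize S W a xs ↔ f.Realize (a ∘ g) xs := by
  induction f with
  | falsum => exact Iff.rfl
  | equal t₁ t₂ =>
    simp only [ofBounded, Realize, Language.Term.realize_relabel, Sum.elim_comp_map,
      Function.comp_id]
    exact Iff.rfl
  | rel R ts =>
    simp only [ofBounded, Realize, Language.Term.realize_relabel, Sum.elim_comp_map,
      Function.comp_id]
    exact Iff.rfl
  | imp f₁ f₂ h₁ h₂ => exact imp_congr (h₁ xs) (h₂ xs)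
  | all f h => exact forall_congr' fun b => h _

theorem realize_ofSentence (S : PotentialistSystem.{u, v, w, y, z} L M) (σ : L.Sentence)
    {W : S.World} (a : α → S.dom W) (xs : Fin 0 → S.dom W) :
    (ofSentence σ : PotFormula L M α 0).Realize S W a xs ↔ (S.dom W) ⊨ σ := by
  rw [ofSentence, realize_ofBounded, Subsingleton.elim (a ∘ _) default,
    Subsingleton.elim xs default]
  rfl

end PotFormula

namespace PotentialistSystem

variable {L : FirstOrder.Language.{u, v}} {M : Type w} (S : PotentialistSystem.{u, v, w, x, y} L M)

/-- Truth of a substitution instance at a world is truth in a Kripke model on its future. -/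
theorem holds_instantiate_iff (W : S.World) (ψ : ℕ → S.Assertion W) (φ : ModalProp) :
    S.Holds W (PotFormula.instantiate ψ φ) ↔
      Sat (fun U X : {U // S.Acc W U} => S.Acc U X)
        (fun i U => (ψ i).Realize S U (Set.inclusion (S.dom_mono W U U.2)) Fin.elim0)
        φ ⟨W, S.acc_refl W⟩ := by
  have key : ∀ U : {U // S.Acc W U},
      (PotFormula.instantiate ψ φ).Realize S U (Set.inclusion (S.dom_mono W U U.2)) Fin.elim0 ↔
        Sat (fun U X : {U // S.Acc W U} => S.Acc U X)
          (fun i U => (ψ i).Realize S U (Set.inclusion (S.dom_mono W U U.2)) Fin.elim0) φ U := by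
    induction φ with
    | var i => exact fun _ => Iff.rfl
    | bot => exact fun _ => Iff.rfl
    | imp φ₁ φ₂ h₁ h₂ => exact fun U => imp_congr (h₁ U) (h₂ U)
    | box φ ih =>
      intro U
      simp only [PotFormula.instantiate, PotFormula.Realize, Sat, ← ih]
      constructor
      · intro h X hX
        have := h X hX
        rwa [Subsingleton.elim (_ ∘ Fin.elim0) Fin.elim0] at this
      · intro h X hX
        rw [Subsingleton.elim (_ ∘ Fin.elim0) Fin.elim0]
        exact h ⟨X, S.acc_trans _ _ _ U.2 hX⟩ hX
  exact key ⟨W, S.acc_refl W⟩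

theorem valAt_anti {W : S.World} {Γ Δ : Set (S.Assertion W)} (h : Γ ⊆ Δ) :
    S.valAt W Δ ⊆ S.valAt W Γ := fun _ hφ ψ hψ => hφ ψ fun i => h (hψ i)

/-- S4.3 is valid in every forward connected potentialist system. -/
theorem S43_subset_valAt (hS : ∀ W U X, S.Acc W U → S.Acc W X → S.Acc U X ∨ S.Acc X U)
    (W : S.World) (Γ : Set (S.Assertion W)) : S43 ⊆ S.valAt W Γ := fun _ hφ ψ _ =>
  (S.holds_instantiate_iff W ψ _).2 (ProvableS43.sat
    (R := fun U X : {U // S.Acc W U} => S.Acc U X) (fun U => S.acc_refl U)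
    (fun _ _ _ => S.acc_trans _ _ _) (fun _ _ _ => hS _ _ _) hφ _)

end PotentialistSystem

/-! ### Exact validities of rank potentialism -/

section RankSystemWith

variable {L : FirstOrder.Language.{v, w}} {str : ∀ β : Ordinal.{u}, L.Structure (vStage β)}
  {M : Type x} {R : M → Ordinal.{u} → Ordinal.{u} → Prop} {hR : ∀ m β δ, R m β δ → β ≤ δ}

theorem S43_subset_valAt_rankSystemWith (β : Ordinal.{u})
    (Γ : Set ((rankSystemWith L str M R hR).Assertion β)) :
    S43 ⊆ (rankSystemWith L str M R hR).valAt β Γ :=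
  (rankSystemWith L str M R hR).S43_subset_valAt
    (fun _ (U X : Ordinal.{u}) _ _ => le_total U X) β Γ

/-- At the world `V_1`, only the formulas of S4.3 are valid for the sentences of the language of set
theory. -/
theorem valAt_one_rankSystemWith_subset (ι : setLang →ᴸ L)
    (hι : ∀ β : Ordinal.{u}, ι.IsExpansionOn (vStage β))
    (Γ : Set ((rankSystemWith L str M R hR).Assertion (1 : Ordinal.{u})))
    (hΓ : ∀ σ : setLang.Sentence, PotFormula.ofSentence (ι.onSentence σ) ∈ Γ) :
    (rankSystemWith L str M R hR).valAt (1 : Ordinal.{u}) Γ ⊆ S43 := by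
  intro φ hφ
  by_contra hn
  obtain ⟨n, Q, V, htrans, hle, hV⟩ := exists_not_sat_of_not_provableS43 hn
  -- The sentence `σ i` defines the preimage of the valuation of `pᵢ`, so substituting these
  -- sentences reproduces the finite countermodel on the ordinals from 1 on.
  choose σ hσ using fun i => firstOrderProperty_ordinalToFin.{u} Q (V i)
  have h := ((rankSystemWith L str M R hR).holds_instantiate_iff (1 : Ordinal.{u}) _ φ).1
    (hφ (fun i => PotFormula.ofSentence (ι.onSentence (σ i))) fun i => hΓ _)
  refine absurd ((sat_comp_iff (R := fun U X : {U : Ordinal.{u} // 1 ≤ U} => U.1 ≤ X.1) (R' := Q)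
    (V' := V) (fun U => ordinalToFin Q U.1) (fun U X hUX => ordinalToFin_forth htrans hle hUX)
    (fun U k hk => ?_) (fun i U => ?_) φ ⟨1, le_rfl⟩).1 h) (by rwa [ordinalToFin_one])
  · obtain ⟨δ, hδ, h⟩ := ordinalToFin_back htrans hle hk
    exact ⟨⟨δ, le_trans U.2 hδ⟩, hδ, h⟩
  · exact (PotFormula.realize_ofSentence _ _ _ _).trans
      ((ι.realize_onSentence (vStage U.1) (σ i)).trans (hσ i U.1))

end RankSystemWith

theorem valAt_one_rankSystem_subset :
    rankSystem.{u}.valAt (1 : Ordinal.{u}) (rankSystem.{u}.sentences (1 : Ordinal.{u})) ⊆ S43 :=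
  valAt_one_rankSystemWith_subset (.id setLang) (fun _ => inferInstance) _ fun _ => ⟨_, rfl⟩

theorem mainTheorem1 :
    -- some world validates exactly S4.3, with respect to the potentialist language with parameters
    -- as well as with respect to sentences of the language of set theory
    (∃ β : Ordinal.{u},
      S43 = rankSystem.{u}.valAt β Set.univ ∧
      rankSystem.{u}.valAt β Set.univ = rankSystem.{u}.valAt β (rankSystem.{u}.sentences β)) ∧
    -- the modal logic of the system for sentences of the language of set theory
    rankSystem.{u}.val rankSystem.{u}.sentences = S43 ∧
    -- the modal logic of the system for any extension of the language of set theory: any expansion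
    -- of the worlds `(V_β, ∈)` to a larger language `L`, any additional modal operators, and any
    -- class of assertions with parameters that contains the sentences of the language of set theory
    (∀ (L : FirstOrder.Language.{v, w}) (ι : setLang →ᴸ L)
      (str : ∀ β : Ordinal.{u}, L.Structure (vStage β))
      (_ : ∀ β : Ordinal.{u}, ι.IsExpansionOn (vStage β))
      (M : Type x) (R : M → Ordinal.{u} → Ordinal.{u} → Prop)
      (hR : ∀ m β δ, R m β δ → β ≤ δ)
      (Γ : ∀ β, Set ((rankSystemWith L str M R hR).Assertion β)),
      (∀ (β : Ordinal.{u}) (σ : setLang.Sentence),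
        PotFormula.ofSentence (ι.onSentence σ) ∈ Γ β) →
      (rankSystemWith L str M R hR).val Γ = S43) := by
  have h₁ := valAt_one_rankSystem_subset.{u}
  have h₂ := S43_subset_valAt_rankSystemWith.{u} (L := setLang) (str := vStage.structure)
    (R := fun m : Empty => m.elim) (hR := fun m => m.elim)
  have h₃ := rankSystem.{u}.valAt_anti (Set.subset_univ (rankSystem.{u}.sentences (1 : Ordinal.{u})))
  -- At `V_1` the inclusions close up: S4.3, the validities for all assertions, those for sentences,
  -- S4.3 again.
  refine ⟨⟨(1 : Ordinal.{u}), (h₂ _ _).antisymm (h₃.trans h₁), h₃.antisymm (h₁.trans (h₂ _ _))⟩,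
    ?_, fun L ι str hι M R hR Γ hΓ => ?_⟩
  · exact Set.Subset.antisymm (fun φ hφ => h₁ (hφ (1 : Ordinal.{u}))) fun φ hφ β => h₂ β _ hφ
  · exact Set.Subset.antisymm
      (fun φ hφ => valAt_one_rankSystemWith_subset ι hι _ (hΓ 1) (hφ (1 : Ordinal.{u})))
      fun φ hφ β => S43_subset_valAt_rankSystemWith β _ hφ
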